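/- **Setting.** Let $C,r,N$ be integers with $1\le r\le C$, $N\ge 0$. A server holds a library $W=(W_1,\dots,W_N)$ of $N$ files of $F$ bits each. There are $C$ caches and $K=\binom{C}{r}$ users, one user $U_g$ for every $r$-subset $g\subseteq[C]$; $U_g$ has access to the caches in $g$. For $0\le k\le C$ let $\Omega_k$ be the set of $k$-subsets of $[C]$. A *scheme* consists of a randomness $P$, uniform on a finite set, cache functions $Z_c=\psi_c(P,W)$ ($c\in[C]$) and a delivery function $X=\phi(P,(\mathbf d_g)_{g\in\Omega_r},W)$ whose values are bit strings of fixed lengths; $\mathbf d_g\in\mathbb F_2^N$ is the demand vector of $U_g$, who wants $B_g=\sum_n d_{g,n}W_n$. Put $Z_g=(Z_c)_{c\in g}$. The library, $P$ and the demands are independent, the demands of different users are mutually independent, and the library and each demand may have any law. The scheme is a *(demand-)private linear function retrieval (P-LFR) scheme* if, for all such laws and all $g\in\Omega_r$, $$H(B_g\mid X,\mathbf d_g,Z_g)=0,\qquad I\big((\mathbf d_h)_{h\ne g};\,X,\mathbf d_g,Z_g\big)=0 .$$ Let $l$ be the smallest positive integer with $r<2^l$, and for integers $0\le t\le C-r$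 and $F\geq 1$ let $$M_t^{(F)}=\frac{Nt}{C}+\binom{C-r}{t}\binom{C-1}{r-1}\left\lceil\frac{F}{l\binom Ct}\right\rceil\frac lF,\qquad R_t=\frac{\binom{C}{t+r}}{\binom Ct}.$$ **The SP-LFR scheme** (for $0\le t\le C-r$ and $F=\binom Ct B$ with $B\ge1$). Split every file into $\binom Ct$ subfiles $W_{n,T}$, $T\in\Omega_t$, of $B$ bits. Draw, independently and uniformly, security keys $V_S\in\mathbb F_2^B$ ($S\in\Omega_{t+r}$) and vectors $\mathbf P_g\in\mathbb F_2^N$ ($g\in\Omega_r$). For $g\in\Omega_r$, $T\in\Omega_t$ with $g\cap T=\emptyset$ put $K_{g,T}=\sum_n p_{g,n}W_{n,T}$ and $D_{g,T}=K_{g,T}+V_{g\cup T}$. Pad $D_{g,T}$ with zeros, cut it into $\lceil B/l\rceil$ blocks of $l$ bits, identify the blocks with elements of $\mathbb F_{2^l}$ by a fixed bijection $\mathbb F_2^l\to\mathbb F_{2^l}$, and replace every such element $s$ by the $r$ Shamir shares $s+\sum_{k=1}^{r-1}a_kx_j^k$ ($j\in[r]$), with fixed distinct nonzero points $x_1,\dots,x_r\in\mathbb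 F_{2^l}$ and fresh independent uniform coefficients $a_1,\dots,a_{r-1}\in\mathbb F_{2^l}$; this gives shares $D^1_{g,T},\dots,D^r_{g,T}$. Cache $c$ stores all $W_{n,T}$ with $c\in T$, and $D^{j}_{g,T}$ for all disjoint $g,T$ with $c\in g$, where $c$ is the $j$-th element of $g$. The server sends $\mathbf q_g=\mathbf d_g+\mathbf P_g$ for all $g\in\Omega_r$ and, for all $S\in\Omega_{t+r}$, $$Y_S=V_S+\sum_{g\subseteq S,\,|g|=r}\big(B_{g,S\setminus g}+K_{g,S\setminus g}\big),\qquad B_{g,T}=\sum_n d_{g,n}W_{n,T}.$$ **Theorem 2 (P-LFR scheme).** 1. For every $0\le t\le C-r$, $B\ge1$, $F=\binom CtB$, every bijection $\mathbb F_2^l\to\mathbb F_{2^l}$ and all distinct nonzero $x_1,\dots,x_r\in\mathbb F_{2^l}$, removing the security keys from the SP-LFR scheme (i.e. setting all $V_S=0$) gives a P-LFR scheme with subpacketization $\binom Ct$. Each cache has exactly $M_t^{(F)}F$ bits, and the signal has exactly $R_tF+KN$ bits (the $KN$ bits are the vectors $\mathbf q_g$, whose length is negligible compared to $F$). 2. P-LFR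 schemes achieve the lower convex envelope of the memory-rate pairs $$\{(0,N)\}\cup\{(M_t^{(F)},R_t):0\le t\le C-r\}\cup\{(N,0)\},$$ up to a number of transmitted bits that does not depend on $F$. That is, there is a constant $\kappa$, depending only on $C,r,N$, such that for every $F\ge1$ and every $M$ for which the convex hull $\mathcal H_F\subset\mathbb R^2$ of these points contains a point with first coordinate $M$, there is a P-LFR scheme for files of $F$ bits in which each cache has at most $MF$ bits and the signal has at most $RF+\kappa$ bits, where $R=\inf\{R':(M,R')\in\mathcal H_F\}$. -/

import Mathlib

noncomputable section

namespace MultiAccess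

/-! ### Entropy of finite-valued random variables -/

/-- Shannon entropy `H(X)`, in bits, of a finite-valued random variable `X` on `(Ω, p)`. -/
def entropy {Ω α : Type} [Finite α] (p : PMF Ω) (X : Ω → α) : ℝ :=
  ∑' a : α, Real.negMulLog ((p.map X) a).toReal / Real.log 2

/-- Conditional entropy `H(X | Y) = H(X, Y) - H(Y)`. -/
def condEntropy {Ω α β : Type} [Finite α] [Finite β] (p : PMF Ω) (X : Ω → α) (Y : Ω → β) : ℝ :=
  entropy p (fun ω => (X ω, Y ω)) - entropy p Y

/-- Mutual information `I(X; Y) = H(X) - H(X | Y)`. -/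
def mutualInfo {Ω α β : Type} [Finite α] [Finite β] (p : PMF Ω) (X : Ω → α) (Y : Ω → β) : ℝ :=
  entropy p X - condEntropy p X Y

/-! ### The network and its coded caching schemes -/

/-- The `k`-element subsets of the set of `C` caches. The users are `Sub C r`: one user for
each `r`-subset of caches, having access to exactly these caches. -/
abbrev Sub (C k : ℕ) : Type := {g : Finset (Fin C) // g.card = k}

/-- A library of `N` binary files; the bits of a file are indexed by `β`. -/
abbrev Library (N : ℕ) (β : Type) : Type := Fin N → β → ZMod 2

/-- The demand vectors of all users. -/
abbrev Demands (C r N : ℕ) : Type := Sub C r → Fin N → ZMod 2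

/-- The linear combination `a 1 * W 1 + ... + a N * W N` of the files. -/
def linComb {N : ℕ} {β : Type} (a : Fin N → ZMod 2) (W : Library N β) : β → ZMod 2 :=
  fun b => ∑ n, a n * W n b

/-- A scheme for `C` caches, access degree `r` and `N` files with bits indexed by `β`: the finite
set in which the private randomness of the server takes its values, the cache functions and the
delivery function. Cache `c` holds a string of `Nat.card (CacheIx c)` bits, and the transmitted
signal is a string of `Nat.card SendIx` bits. -/
structure Scheme (C r N : ℕ) (β : Type) where
  Rand : Type
  CacheIx : Fin C → Type
  SendIx : Type
  finite_rand : Finite Rand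
  nonempty_rand : Nonempty Rand
  finite_cacheIx : ∀ c, Finite (CacheIx c)
  finite_sendIx : Finite SendIx
  place : ∀ c, Rand → Library N β → CacheIx c → ZMod 2
  send : Rand → Demands C r N → Library N β → SendIx → ZMod 2

namespace Scheme

attribute [instance] finite_rand nonempty_rand finite_cacheIx finite_sendIx

variable {C r N : ℕ} {β : Type} (s : Scheme C r N β)

/-- The outcomes: library, randomness of the server, demands. -/
abbrev Outcome : Type := Library N β × s.Rand × Demands C r N

/-- The joint law of the library, the randomness of the server and the demands: they are
independent, and the randomness is uniform. -/
def law (pW : PMF (Library N β)) (pd : PMF (Demands C r N)) : PMF s.Outcome :=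
  letI : Fintype s.Rand := Fintype.ofFinite _
  pW.bind fun W => (PMF.uniformOfFintype s.Rand).bind fun ρ => pd.map fun d => (W, ρ, d)

/-- The transmitted signal `X`. -/
def signal (ω : s.Outcome) : s.SendIx → ZMod 2 := s.send ω.2.1 ω.2.2 ω.1

/-- The content `Z_g` of all caches which user `g` has access to. -/
def cached (g : Sub C r) (ω : s.Outcome) : ∀ c : {c // c ∈ g.1}, s.CacheIx c.1 → ZMod 2 :=
  fun c => s.place c.1 ω.2.1 ω.1

/-- The demand vector `d_g` of user `g`. -/
def demand (g : Sub C r) (ω : s.Outcome) : Fin N → ZMod 2 := ω.2.2 g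

/-- The demand vectors of all users other than `g`. -/
def otherDemands (g : Sub C r) (ω : s.Outcome) : {h : Sub C r // h ≠ g} → Fin N → ZMod 2 :=
  fun h => ω.2.2 h.1

/-- The linear combination `B_g` of the files which user `g` demands. -/
def wanted (g : Sub C r) (ω : s.Outcome) : β → ZMod 2 := linComb (ω.2.2 g) ω.1

end Scheme

/-- The demand vectors of the different users are mutually independent under `pd`. -/
def IndepDemands {C r N : ℕ} (pd : PMF (Demands C r N)) : Prop :=
  ∃ q : Sub C r → PMF (Fin N → ZMod 2), ∀ d, pd d = ∏ g, q g (d g)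

/-- Correctness `H(B_g | X, d_g, Z_g) = 0` for every user `g`. -/
def Scheme.Correct {C r N : ℕ} {β : Type} [Finite β] (s : Scheme C r N β) : Prop :=
  ∀ (pW : PMF (Library N β)) (pd : PMF (Demands C r N)), IndepDemands pd → ∀ g : Sub C r,
    condEntropy (s.law pW pd) (s.wanted g) (fun ω => (s.signal ω, s.demand g ω, s.cached g ω)) = 0

/-- Demand privacy `I(d_{others}; X, d_g, Z_g) = 0` for every user `g`. -/
def Scheme.DemandPrivate {C r N : ℕ} {β : Type} [Finite β] (s : Scheme C r N β) : Prop :=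
  ∀ (pW : PMF (Library N β)) (pd : PMF (Demands C r N)), IndepDemands pd → ∀ g : Sub C r,
    mutualInfo (s.law pW pd) (s.otherDemands g)
      (fun ω => (s.signal ω, s.demand g ω, s.cached g ω)) = 0

/-- A private linear function retrieval (P-LFR) scheme. -/
def Scheme.IsPLFR {C r N : ℕ} {β : Type} [Finite β] (s : Scheme C r N β) : Prop :=
  s.Correct ∧ s.DemandPrivate

/-! ### The SP-LFR scheme, and the scheme without its security keys -/

/-- The smallest positive integer `l` with `r < 2 ^ l`. -/
def symBits (r : ℕ) : ℕ := sInf {l : ℕ | 0 < l ∧ r < 2 ^ l}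

/-- The field with `2 ^ l` elements, `l = symBits r`. -/
abbrev ShareField (r : ℕ) : Type := GaloisField 2 (symBits r)

/-- The pairs of a user `g` and a disjoint `t`-subset `T` of the caches. -/
abbrev KeyIx (C r t : ℕ) : Type := {q : Sub C r × Sub C t // Disjoint q.1.1 q.2.1}

/-- `g ∪ T` for disjoint `g` and `T`. -/
def KeyIx.union {C r t : ℕ} (q : KeyIx C r t) : Sub C (t + r) :=
  ⟨q.1.1.1 ∪ q.1.2.1, by
    rw [Finset.card_union_of_disjoint q.2, q.1.1.2, q.1.2.2, Nat.add_comm]⟩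

/-- The position of `c` among the elements of `g`, in increasing order. -/
def position {C r : ℕ} (g : Sub C r) (c : Fin C) (hc : c ∈ g.1) : Fin r :=
  (g.1.orderIsoOfFin g.2).symm ⟨c, hc⟩

/-- The `m`-th block of `l` bits of a string of `B` bits, padded with zeros at the end. -/
def block {B : ℕ} (l : ℕ) (D : Fin B → ZMod 2) (m : ℕ) : Fin l → ZMod 2 :=
  fun k => if h : m * l + k < B then D ⟨m * l + k, h⟩ else 0

/-- Shamir's share of the secret `s`: the value at `x` of the polynomial
`s + a 0 * X + ... + a (r - 2) * X ^ (r - 1)`. -/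
def shamirShare {L : Type} [Field L] {r : ℕ} (s : L) (a : Fin (r - 1) → L) (x : L) : L :=
  s + ∑ k, a k * x ^ ((k : ℕ) + 1)

/-- The security keys: independent uniform strings of `B` bits, one for each `(t+r)`-subset. -/
abbrev SecurityKeys (C r t B : ℕ) : Type := Sub C (t + r) → Fin B → ZMod 2

/-- The other randomness of the scheme: a uniform vector `P_g` for each user `g`, and the random
coefficients for secret sharing, for each key and each of the `⌈B / l⌉` symbols of the key. -/
abbrev PrivacyRand (C r N t B : ℕ) : Type :=
  (Sub C r → Fin N → ZMod 2) ×
    (KeyIx C r t → Fin (B ⌈/⌉ symBits r) → Fin (r - 1) → ShareField r)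

/-- The SP-LFR scheme. Each file consists of `C.choose t` subfiles of `B` bits, indexed by the
`t`-subsets of the caches. The elements of the field with `2 ^ l` elements are written with `l`
bits through `e`, and the `r` shares are the values of the polynomials at `x 0, ..., x (r-1)`. -/
def spLFR (C r N t B : ℕ) (e : (Fin (symBits r) → ZMod 2) ≃ ShareField r)
    (x : Fin r → ShareField r) : Scheme C r N (Sub C t × Fin B) where
  Rand := SecurityKeys C r t B × PrivacyRand C r N t B
  CacheIx c :=
    (Fin N × {T : Sub C t // c ∈ T.1} × Fin B) ⊕
      ({q : KeyIx C r t // c ∈ q.1.1.1} × Fin (B ⌈/⌉ symBits r) × Fin (symBits r))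
  SendIx := (Sub C (t + r) × Fin B) ⊕ (Sub C r × Fin N)
  finite_rand := inferInstance
  nonempty_rand := inferInstance
  finite_cacheIx := inferInstance
  finite_sendIx := inferInstance
  place c := fun (V, P, a) W => Sum.elim
    (fun (n, T, b) => W n (T.1, b))
    (fun (q, m, k) =>
      let D : Fin B → ZMod 2 := fun b => linComb (P q.1.1.1) W (q.1.1.2, b) + V q.1.union b
      e.symm (shamirShare (e (block (symBits r) D m)) (a q.1 m)
        (x (position q.1.1.1 c q.2))) k)
  send := fun (V, P, _) d W => Sum.elim
    (fun (S, b) => V S b + ∑ g : Sub C r, ∑ T : Sub C t,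
      if g.1 ⊆ S.1 ∧ T.1 = S.1 \ g.1 then
        linComb (d g) W (T, b) + linComb (P g) W (T, b) else 0)
    (fun (g, n) => d g n + P g n)

/-- The P-LFR scheme: the SP-LFR scheme without security keys, that is, with all of them replaced
by zero. -/
def pLFR (C r N t B : ℕ) (e : (Fin (symBits r) → ZMod 2) ≃ ShareField r)
    (x : Fin r → ShareField r) : Scheme C r N (Sub C t × Fin B) where
  Rand := PrivacyRand C r N t B
  CacheIx := (spLFR C r N t B e x).CacheIx
  SendIx := (spLFR C r N t B e x).SendIx
  finite_rand := inferInstance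
  nonempty_rand := inferInstance
  finite_cacheIx := inferInstance
  finite_sendIx := inferInstance
  place c ρ W := (spLFR C r N t B e x).place c (0, ρ) W
  send ρ d W := (spLFR C r N t B e x).send (0, ρ) d W

/-! ### Memory-rate pairs -/

/-- The cache size, in files of `F` bits. -/
def memP (C r N F t : ℕ) : ℝ :=
  (N : ℝ) * t / C + ((C - r).choose t : ℝ) * ((C - 1).choose (r - 1) : ℝ) *
    (⌈(F : ℝ) / ((symBits r : ℝ) * (C.choose t : ℝ))⌉₊ : ℝ) * ((symBits r : ℝ) / F)

/-- The rate, in files. -/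
def rateP (C r t : ℕ) : ℝ := (C.choose (t + r) : ℝ) / (C.choose t : ℝ)

/-- The corner points `(0, N)`, `(memP t, rateP t)` for `0 ≤ t ≤ C - r`, and `(N, 0)`. -/
def cornerPoints (C r N F : ℕ) : Set (ℝ × ℝ) :=
  {((0 : ℝ), (N : ℝ))} ∪ {p | ∃ t : ℕ, t + r ≤ C ∧ p = (memP C r N F t, rateP C r t)} ∪
    {((N : ℝ), (0 : ℝ))}

/-- The lower convex envelope of a set of points of the plane, as a function on the projection of
the convex hull to the first coordinate. -/
def lowerConvexEnvelope (S : Set (ℝ × ℝ)) (M : ℝ) : ℝ :=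
  sInf {R : ℝ | (M, R) ∈ convexHull ℝ S}

end MultiAccess

end

/-!
Correctness and demand privacy reduce to properties of the cache and delivery functions alone.
A conditional entropy vanishes as soon as the first variable is a function of the second. For
privacy, if every change of the other demands can be undone by a permutation of the uniform
randomness without changing what a user sees, then the law of the user's view does not depend on
these demands, and the joint law of the two factors.

In the P-LFR scheme the demands enter the signal only through `q = d + P`. User `g` knows every
subfile `T` that meets `g`; for `T` disjoint from `g`, the transmission of `g ∪ T` contains, besides
the combination for `(g, T)`, only known subfiles, and the `r` shares in the caches of `g` reveal
the key to be removed. A change of `d` is undone by moving it into `P`, which alters keys of users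
`h ≠ g` only; such an `h` has a cache outside `g`, so one of the shares of its keys is unseen and a
shift of the Shamir coefficients restores all the seen ones.

For the envelope, a point of the convex hull is a convex combination of at most three corner points
(Carathéodory). Memory sharing with these weights, each part rounded down to a length on which the
scheme of its corner needs no padding and the remaining bits sent uncoded, loses only a number of
bits that does not depend on `F`.
-/

noncomputable section

namespace MultiAccess

/-! ### Product laws -/

section ProductLaws

variable {α β ι : Type*}

/-- The joint law of two independent random variables with laws `μ` and `ν`. It is written as a
`bind` so that the monad laws of `PMF` apply to it. -/
def prodLaw (μ : PMF α) (ν : PMF β) : PMF (α × β) :=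
  μ.bind fun a => ν.map (Prod.mk a)

theorem map_apply_of_injective (p : PMF α) {i : α → β} (hi : Function.Injective i) (a : α) :
    (p.map i) (i a) = p a := by
  rw [PMF.map_apply, tsum_eq_single a fun a' ha' => if_neg (hi.ne ha'.symm), if_pos rfl]

theorem map_apply_eq_zero_of_notMem_range (p : PMF α) {i : α → β} {b : β}
    (hb : b ∉ Set.range i) : (p.map i) b = 0 := by
  rw [PMF.apply_eq_zero_iff, PMF.support_map]
  exact fun h => hb (Set.image_subset_range _ _ h)

theorem prodLaw_apply (μ : PMF α) (ν : PMF β) (a : α) (b : β) :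
    prodLaw μ ν (a, b) = μ a * ν b := by
  rw [prodLaw, PMF.bind_apply, tsum_eq_single a]
  · rw [map_apply_of_injective ν (Prod.mk_right_injective a)]
  · intro a' ha'
    rw [map_apply_eq_zero_of_notMem_range ν, mul_zero]
    rintro ⟨b', hb'⟩
    exact ha' (Prod.mk.inj hb').1

theorem map_fst_prodLaw (μ : PMF α) (ν : PMF β) : (prodLaw μ ν).map Prod.fst = μ := by
  have (a : α) : (Prod.fst ∘ Prod.mk a : β → α) = Function.const β a := rfl
  simp only [prodLaw, PMF.map_bind, PMF.map_comp, this, PMF.map_const, PMF.bind_pure]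

theorem map_snd_prodLaw (μ : PMF α) (ν : PMF β) : (prodLaw μ ν).map Prod.snd = ν := by
  have (a : α) : (Prod.snd ∘ Prod.mk a : β → β) = id := rfl
  simp only [prodLaw, PMF.map_bind, PMF.map_comp, this, PMF.map_id, PMF.bind_const]

theorem sum_toReal_apply [Fintype α] (p : PMF α) : ∑ a, (p a).toReal = 1 := by
  rw [← ENNReal.toReal_sum fun a _ => p.apply_ne_top a, ← tsum_fintype (L := .unconditional _),
    p.tsum_coe, ENNReal.toReal_one]

/-- The joint law of independent random variables with laws `q i`. -/
def piLaw [Fintype ι] [DecidableEq ι] [Fintype α] (q : ι → PMF α) : PMF (ι → α) :=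
  PMF.ofFintype (fun a => ∏ i, q i (a i)) <| by
    rw [← Fintype.piFinset_univ, Finset.sum_prod_piFinset]
    simp only [← tsum_fintype (L := .unconditional _), PMF.tsum_coe, Finset.prod_const_one]

theorem eq_map_funSplitAt_symm_prodLaw [Fintype ι] [DecidableEq ι] [Fintype α] {p : PMF (ι → α)}
    {q : ι → PMF α} (hp : ∀ a, p a = ∏ i, q i (a i)) (i : ι) :
    p = (prodLaw (q i) (piLaw fun j : {j // j ≠ i} => q j)).map (Equiv.funSplitAt i α).symm := by
  ext a
  obtain ⟨⟨x, a⟩, rfl⟩ := (Equiv.funSplitAt i α).symm.surjective a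
  rw [map_apply_of_injective _ (Equiv.injective _), prodLaw_apply, hp,
    Fintype.prod_eq_mul_prod_subtype_ne _ i]
  simp [piLaw, Equiv.funSplitAt_symm_apply, fun j : {j // j ≠ i} => j.2]

end ProductLaws

/-! ### Entropy of determined and of independent random variables -/

section Entropy

variable {Ω α β : Type} [Finite α] [Finite β] (p : PMF Ω)

theorem entropy_comp_of_injective (Y : Ω → α) {i : α → β} (hi : Function.Injective i) :
    entropy p (i ∘ Y) = entropy p Y := by
  rw [entropy, ← PMF.map_comp, entropy, ← hi.tsum_eq]
  · simp only [map_apply_of_injective _ hi]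
  · intro b hb
    contrapose! hb
    rw [Function.notMem_support, map_apply_eq_zero_of_notMem_range _ hb, ENNReal.toReal_zero,
      Real.negMulLog_zero, zero_div]

theorem condEntropy_eq_zero_of_factorsThrough {X : Ω → α} {Y : Ω → β}
    (h : X.FactorsThrough Y) : condEntropy p X Y = 0 := by
  obtain ⟨ω₀, -⟩ := p.support_nonempty
  have : Nonempty α := ⟨X ω₀⟩
  obtain ⟨f, rfl⟩ := (Function.factorsThrough_iff X).1 h
  rw [condEntropy, sub_eq_zero]
  exact entropy_comp_of_injective p Y (i := fun b => (f b, b)) fun _ _ h => (Prod.mk.inj h).2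

variable {p}

theorem entropy_prodMk_of_map_eq_prodLaw {X : Ω → α} {Y : Ω → β} {μ : PMF α} {ν : PMF β}
    (h : p.map (fun ω => (X ω, Y ω)) = prodLaw μ ν) :
    entropy p (fun ω => (X ω, Y ω)) = entropy p X + entropy p Y := by
  cases nonempty_fintype α
  cases nonempty_fintype β
  have hX : p.map X = μ := by rw [← map_fst_prodLaw μ ν, ← h, PMF.map_comp]; rfl
  have hY : p.map Y = ν := by rw [← map_snd_prodLaw μ ν, ← h, PMF.map_comp]; rfl
  simp only [entropy, tsum_fintype, hX, hY, h, Fintype.sum_prod_type, prodLaw_apply,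
    ENNReal.toReal_mul, Real.negMulLog_mul, add_div, Finset.sum_add_distrib, mul_div_assoc,
    ← Finset.sum_mul, ← Finset.mul_sum, sum_toReal_apply, one_mul]

theorem mutualInfo_eq_zero_of_map_eq_prodLaw {X : Ω → α} {Y : Ω → β} {μ : PMF α} {ν : PMF β}
    (h : p.map (fun ω => (X ω, Y ω)) = prodLaw μ ν) : mutualInfo p X Y = 0 := by
  rw [mutualInfo, condEntropy, entropy_prodMk_of_map_eq_prodLaw h]
  ring

end Entropy

/-! ### Criteria for correctness and demand privacy -/

namespace Scheme

variable {C r N : ℕ} {β : Type} (s : Scheme C r N β)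

/-- The values of a signal, a demand vector and the content of the caches of user `g`. -/
abbrev View (g : Sub C r) : Type :=
  (s.SendIx → ZMod 2) × (Fin N → ZMod 2) × (∀ c : {c // c ∈ g.1}, s.CacheIx c.1 → ZMod 2)

/-- What user `g` sees: the signal, its own demand vector and the content of its caches. -/
def observation (g : Sub C r) (ω : s.Outcome) : s.View g :=
  (s.signal ω, s.demand g ω, s.cached g ω)

theorem observation_eq_iff {g : Sub C r} {W W' : Library N β} {ρ ρ' : s.Rand}
    {d d' : Demands C r N} :
    s.observation g (W, ρ, d) = s.observation g (W', ρ', d') ↔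
      s.send ρ d W = s.send ρ' d' W' ∧ d g = d' g ∧
        ∀ c ∈ g.1, s.place c ρ W = s.place c ρ' W' := by
  simp only [observation, signal, demand, cached, Prod.mk.injEq, funext_iff, Subtype.forall]

/-- The linear combination demanded by a user is a function of what the user sees. -/
def Decodable : Prop :=
  ∀ g, (s.wanted g).FactorsThrough (s.observation g)

/-- A change of the demands of the other users can be compensated by a permutation of the
randomness which preserves what the user sees. This makes demand privacy, a statement about laws,
a property of the cache and delivery functions. -/
def Masked : Prop :=
  ∀ (g : Sub C r) (W : Library N β) (d d' : Demands C r N), d g = d' g →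
    ∃ σ : Equiv.Perm s.Rand, ∀ ρ,
      s.observation g (W, σ ρ, d') = s.observation g (W, ρ, d)

/-- The law of what user `g` sees, for a fixed library and fixed demands. -/
def observationLaw (g : Sub C r) (W : Library N β) (d : Demands C r N) :
    PMF (s.View g) :=
  letI : Fintype s.Rand := Fintype.ofFinite _
  (PMF.uniformOfFintype s.Rand).map fun ρ => s.observation g (W, ρ, d)

theorem map_otherDemands_observation_law (pW : PMF (Library N β)) (pd : PMF (Demands C r N))
    (g : Sub C r) :
    (s.law pW pd).map (fun ω => (s.otherDemands g ω, s.observation g ω)) =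
      pd.bind fun d => pW.bind fun W =>
        (s.observationLaw g W d).map (Prod.mk fun h : {h // h ≠ g} => d h) := by
  let : Fintype s.Rand := Fintype.ofFinite _
  calc
    _ = pW.bind fun W => (PMF.uniformOfFintype s.Rand).bind fun ρ => pd.bind fun d =>
          PMF.pure (s.otherDemands g (W, ρ, d), s.observation g (W, ρ, d)) := by
      simp only [law, PMF.map_bind, PMF.map_comp]
      rfl
    _ = pW.bind fun W => pd.bind fun d => (PMF.uniformOfFintype s.Rand).bind fun ρ =>
          PMF.pure (s.otherDemands g (W, ρ, d), s.observation g (W, ρ, d)) := by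
      simp only [PMF.bind_comm _ pd]
    _ = _ := by
      rw [PMF.bind_comm]
      simp only [observationLaw, PMF.map_comp]
      rfl

variable {s}

theorem Decodable.correct [Finite β] (hs : s.Decodable) : s.Correct :=
  fun _ _ _ g => condEntropy_eq_zero_of_factorsThrough _ (hs g)

theorem Masked.observationLaw_eq (hs : s.Masked) (g : Sub C r) (W : Library N β)
    {d d' : Demands C r N} (hd : d g = d' g) :
    s.observationLaw g W d = s.observationLaw g W d' := by
  let : Fintype s.Rand := Fintype.ofFinite _
  obtain ⟨σ, hσ⟩ := hs g W d d' hd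
  have hU : (PMF.uniformOfFintype s.Rand).map σ = PMF.uniformOfFintype s.Rand := by
    ext ρ
    obtain ⟨ρ, rfl⟩ := σ.surjective ρ
    rw [map_apply_of_injective _ σ.injective, PMF.uniformOfFintype_apply,
      PMF.uniformOfFintype_apply]
  have hobs : (fun ρ => s.observation g (W, ρ, d)) =
      (fun ρ => s.observation g (W, ρ, d')) ∘ σ := funext fun ρ => (hσ ρ).symm
  rw [observationLaw, hobs, ← PMF.map_comp, hU, observationLaw]

theorem Masked.demandPrivate [Finite β] (hs : s.Masked) : s.DemandPrivate := by
  classical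
  rintro pW pd ⟨q, hq⟩ g
  let glue (x : Fin N → ZMod 2) (a : {h // h ≠ g} → Fin N → ZMod 2) : Demands C r N :=
    (Equiv.funSplitAt g _).symm (x, a)
  have glue_self (x a) : glue x a g = x := by simp [glue]
  have glue_other (x a) : (fun h : {h // h ≠ g} => glue x a h) = a := by
    funext h
    simp [glue, h.2]
  refine mutualInfo_eq_zero_of_map_eq_prodLaw
    (μ := piLaw fun h : {h // h ≠ g} => q h)
    (ν := (q g).bind fun x => pW.bind fun W => s.observationLaw g W (glue x 0)) ?_
  calc
    _ = (q g).bind fun x => (piLaw fun h : {h // h ≠ g} => q h).bind fun a => pW.bind fun W =>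
          (s.observationLaw g W (glue x a)).map (Prod.mk fun h : {h // h ≠ g} => glue x a h) := by
      refine (s.map_otherDemands_observation_law pW pd g).trans ?_
      rw [eq_map_funSplitAt_symm_prodLaw hq g, PMF.bind_map, prodLaw, PMF.bind_bind]
      simp only [PMF.bind_map, Function.comp_def, glue]
    _ = (q g).bind fun x => (piLaw fun h : {h // h ≠ g} => q h).bind fun a => pW.bind fun W =>
          (s.observationLaw g W (glue x 0)).map (Prod.mk a) := by
      simp only [glue_other]
      congr! 7 with x a W
      exact hs.observationLaw_eq g W (by rw [glue_self, glue_self])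
    _ = _ := by
      rw [PMF.bind_comm, prodLaw]
      simp only [PMF.map_bind]

theorem isPLFR_of_decodable_of_masked [Finite β] (hd : s.Decodable) (hm : s.Masked) :
    s.IsPLFR :=
  ⟨hd.correct, hm.demandPrivate⟩

end Scheme

/-! ### Shamir's secret sharing -/

section Shamir

open Polynomial

variable {L : Type} [Field L] {r : ℕ}

/-- The polynomial `s + a 0 * X + ... + a (r - 2) * X ^ (r - 1)` whose values are the shares of the
secret `s`. Its coefficients are listed by `Fin (r - 1 + 1)`, which is `Fin r` up to the
equality `r - 1 + 1 = r`. -/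
def shamirPoly (s : L) (a : Fin (r - 1) → L) : L[X] :=
  ∑ i : Fin (r - 1 + 1), C ((Fin.cons s a : Fin (r - 1 + 1) → L) i) * X ^ (i : ℕ)

theorem degree_shamirPoly_lt (s : L) (a : Fin (r - 1) → L) :
    (shamirPoly s a).degree < (r - 1 + 1 : ℕ) :=
  degree_sum_fin_lt _

theorem eval_shamirPoly (s : L) (a : Fin (r - 1) → L) (y : L) :
    (shamirPoly s a).eval y = shamirShare s a y := by
  simp [shamirPoly, shamirShare, eval_finsetSum, Fin.sum_univ_succ]

theorem shamirShare_zero_right (s : L) (a : Fin (r - 1) → L) : shamirShare s a 0 = s := by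
  simp [shamirShare]

theorem shamirShare_add (s s' : L) (a a' : Fin (r - 1) → L) (y : L) :
    shamirShare (s + s') (a + a') y = shamirShare s a y + shamirShare s' a' y := by
  simp only [shamirShare, Pi.add_apply, add_mul, Finset.sum_add_distrib]
  ring

theorem eval_eq_shamirShare {p : L[X]} (hp : p.natDegree < r - 1 + 1) (y : L) :
    p.eval y = shamirShare (p.coeff 0) (fun k : Fin (r - 1) => p.coeff (k + 1)) y := by
  rw [eval_eq_sum_range' hp, Finset.sum_range_succ', shamirShare,
    Fin.sum_univ_eq_sum_range (fun k => p.coeff (k + 1) * y ^ (k + 1)), pow_zero, mul_one, add_comm]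

theorem eq_of_shamirShare_eq (hr : 0 < r) {x : Fin r → L} (hx : Function.Injective x) {s s' : L}
    {a a' : Fin (r - 1) → L} (h : ∀ j, shamirShare s a (x j) = shamirShare s' a' (x j)) :
    s = s' := by
  have hcard : r - 1 + 1 = (Finset.univ : Finset (Fin r)).card := by
    rw [Finset.card_fin, Nat.sub_add_cancel hr]
  have hpoly : shamirPoly s a = shamirPoly s' a' :=
    eq_of_degrees_lt_of_eval_index_eq Finset.univ hx.injOn
      (hcard ▸ degree_shamirPoly_lt s a) (hcard ▸ degree_shamirPoly_lt s' a')
      fun j _ => by rw [eval_shamirPoly, eval_shamirPoly, h]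
  rw [← shamirShare_zero_right s a, ← eval_shamirPoly, hpoly, eval_shamirPoly,
    shamirShare_zero_right]

/-- The shift `δ` consists of the nonconstant coefficients of the polynomial of degree `r - 1` that
vanishes at all points but `x j₀` and takes the value `s' - s` at zero. -/
theorem exists_shamirShare_add_eq {x : Fin r → L} (hx : ∀ j, x j ≠ 0) (j₀ : Fin r) (s s' : L) :
    ∃ δ : Fin (r - 1) → L, ∀ a, ∀ j ≠ j₀, shamirShare s' (a + δ) (x j) = shamirShare s a (x j) := by
  let v : L[X] := Lagrange.nodal (Finset.univ.erase j₀) x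
  have hv : v.eval 0 ≠ 0 := by
    simp only [v, Lagrange.eval_nodal, zero_sub]
    exact Finset.prod_ne_zero_iff.2 fun j _ => neg_ne_zero.2 (hx j)
  let p : L[X] := C ((s' - s) / v.eval 0) * v
  have hp0 : p.coeff 0 = s' - s := by
    rw [coeff_zero_eq_eval_zero, eval_mul, eval_C, div_mul_cancel₀ _ hv]
  have hpdeg : p.natDegree < r - 1 + 1 := by
    refine Nat.lt_succ_of_le ((natDegree_C_mul_le _ _).trans ?_)
    rw [Lagrange.natDegree_nodal, Finset.card_erase_of_mem (Finset.mem_univ j₀), Finset.card_fin]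
  refine ⟨fun k => p.coeff (k + 1), fun a j hj => ?_⟩
  have hpj : p.eval (x j) = 0 := by
    rw [eval_mul, Lagrange.eval_nodal_at_node (Finset.mem_erase.2 ⟨hj, Finset.mem_univ j⟩),
      mul_zero]
  rw [eval_eq_shamirShare hpdeg, hp0] at hpj
  rw [← add_sub_cancel s s', shamirShare_add, hpj, add_zero]

end Shamir

/-! ### The P-LFR scheme -/

theorem block_injective {B l : ℕ} (hl : 0 < l) {D D' : Fin B → ZMod 2}
    (h : ∀ m : Fin (B ⌈/⌉ l), block l D m = block l D' m) : D = D' := by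
  funext b
  have hm : b.1 / l < B ⌈/⌉ l := by
    by_contra! hle
    have := (ceilDiv_le_iff_le_mul hl).1 hle
    exact absurd b.2 (this.trans (Nat.mul_div_le _ _)).not_gt
  have hb : b.1 / l * l + b.1 % l = b.1 := Nat.div_add_mod' _ _
  simpa [block, hb] using congrFun (h ⟨_, hm⟩) ⟨b.1 % l, Nat.mod_lt _ hl⟩

theorem linComb_add {N : ℕ} {β : Type} (a a' : Fin N → ZMod 2) (W : Library N β) :
    linComb (a + a') W = linComb a W + linComb a' W := by
  funext b
  simp only [linComb, Pi.add_apply, add_mul, Finset.sum_add_distrib]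

theorem linComb_congr {N : ℕ} {β : Type} (a : Fin N → ZMod 2) {W W' : Library N β} {b : β}
    (h : ∀ n, W n b = W' n b) : linComb a W b = linComb a W' b := by
  simp only [linComb, h]

theorem symBits_spec (r : ℕ) : 0 < symBits r ∧ r < 2 ^ symBits r :=
  Nat.sInf_mem (s := {l : ℕ | 0 < l ∧ r < 2 ^ l})
    ⟨r + 1, r.succ_pos, r.lt_two_pow_self.trans (Nat.pow_lt_pow_succ one_lt_two)⟩

theorem exists_position_eq {C r : ℕ} (g : Sub C r) (j : Fin r) :
    ∃ c, ∃ hc : c ∈ g.1, position g c hc = j :=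
  ⟨_, (g.1.orderIsoOfFin g.2 j).2, OrderIso.symm_apply_apply _ j⟩

theorem position_injective {C r : ℕ} (g : Sub C r) {c c' : Fin C} (hc : c ∈ g.1) (hc' : c' ∈ g.1)
    (h : position g c hc = position g c' hc') : c = c' := by
  simpa [position] using h

theorem eq_of_val_subset_val {C k : ℕ} {g h : Sub C k} (hgh : g.1 ⊆ h.1) : g = h :=
  Subtype.ext (Finset.eq_of_subset_of_card_le hgh (h.2.trans g.2.symm).le)

theorem eq_of_disjoint_sdiff {C k : ℕ} {g h : Sub C k} {S : Finset (Fin C)} (hg : g.1 ⊆ S)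
    (hdisj : Disjoint g.1 (S \ h.1)) : g = h := by
  refine eq_of_val_subset_val fun c hc => ?_
  by_contra hch
  exact Finset.disjoint_left.1 hdisj hc (Finset.mem_sdiff.2 ⟨hg hc, hch⟩)

theorem eq_of_sum_eq_sum_of_forall_ne {ι M : Type*} [Fintype ι] [AddCommGroup M] {f f' : ι → M}
    (i : ι) (hsum : ∑ j, f j = ∑ j, f' j) (hne : ∀ j ≠ i, f j = f' j) : f i = f' i := by
  have hsingle : ∑ j, (f j - f' j) = f i - f' i :=
    Fintype.sum_eq_single i fun j hj => sub_eq_zero.2 (hne j hj)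
  rw [← sub_eq_zero, ← hsingle, Finset.sum_sub_distrib, hsum, sub_self]

section PLFR

variable {C r N t B : ℕ} {e : (Fin (symBits r) → ZMod 2) ≃ ShareField r}
  {x : Fin r → ShareField r}

/-- The signal of the P-LFR scheme as a function of the masked demand vectors
`u g = d g + P g`, the only way in which the demands enter it. -/
def maskedSignal (u : Demands C r N) (W : Library N (Sub C t × Fin B)) :
    (Sub C (t + r) × Fin B) ⊕ (Sub C r × Fin N) → ZMod 2 :=
  Sum.elim
    (fun (S, b) => ∑ q : Sub C r × Sub C t,
      if q.1.1 ⊆ S.1 ∧ q.2.1 = S.1 \ q.1.1 then linComb (u q.1) W (q.2, b) else 0)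
    (fun (g, n) => u g n)

theorem pLFR_send (ρ : (pLFR C r N t B e x).Rand) (d : Demands C r N)
    (W : Library N (Sub C t × Fin B)) :
    (pLFR C r N t B e x).send ρ d W = maskedSignal (d + ρ.1) W := by
  funext i
  rcases i with ⟨S, b⟩ | ⟨g, n⟩
  · simp only [maskedSignal, Sum.elim_inl, Fintype.sum_prod_type, Pi.add_apply, linComb_add]
    exact zero_add _
  · rfl

theorem eq_of_maskedSignal_eq {u u' : Demands C r N} {W W' : Library N (Sub C t × Fin B)}
    (h : maskedSignal u W = maskedSignal u' W') : u = u' :=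
  funext fun g => funext fun n => congrFun h (.inr (g, n))

theorem linComb_eq_of_maskedSignal_eq {u u' : Demands C r N}
    {W W' : Library N (Sub C t × Fin B)} {g : Sub C r}
    (hsignal : maskedSignal u W = maskedSignal u' W')
    (hcached : ∀ T : Sub C t, ¬ Disjoint g.1 T.1 → ∀ b n, W n (T, b) = W' n (T, b))
    {T : Sub C t} (hT : Disjoint g.1 T.1) (b : Fin B) :
    linComb (u g) W (T, b) = linComb (u g) W' (T, b) := by
  obtain rfl := eq_of_maskedSignal_eq hsignal
  let S : Sub C (t + r) := KeyIx.union ⟨(g, T), hT⟩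
  have hgS : g.1 ⊆ S.1 := Finset.subset_union_left
  have hTS : T.1 = S.1 \ g.1 := (Finset.union_sdiff_cancel_left hT).symm
  have hterm := eq_of_sum_eq_sum_of_forall_ne (g, T) (congrFun hsignal (.inl (S, b))) ?_
  · simpa only [if_pos (And.intro hgS hTS)] using hterm
  rintro ⟨h, T'⟩ hne
  split_ifs with hhT'
  · refine linComb_congr _ (hcached T' (fun hdisj => hne ?_) b)
    obtain rfl := eq_of_disjoint_sdiff hgS (hhT'.2 ▸ hdisj)
    exact Prod.ext rfl (Subtype.ext (hhT'.2.trans hTS.symm))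
  · rfl

/-- The `m`-th symbol of the key `∑ n, p n * W_{n, T}`. -/
def keySymbol (e : (Fin (symBits r) → ZMod 2) ≃ ShareField r) (p : Fin N → ZMod 2)
    (W : Library N (Sub C t × Fin B)) (T : Sub C t) (m : ℕ) : ShareField r :=
  e (block (symBits r) (fun b => linComb p W (T, b)) m)

theorem pLFR_place_inr (ρ : (pLFR C r N t B e x).Rand) (W : Library N (Sub C t × Fin B))
    (c : Fin C) (q : {q : KeyIx C r t // c ∈ q.1.1.1}) (m : Fin (B ⌈/⌉ symBits r))
    (k : Fin (symBits r)) :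
    (pLFR C r N t B e x).place c ρ W (.inr (q, m, k)) =
      e.symm (shamirShare (keySymbol e (ρ.1 q.1.1.1) W q.1.1.2 m) (ρ.2 q.1 m)
        (x (position q.1.1.1 c q.2))) k := by
  change e.symm (shamirShare (e (block (symBits r)
    (fun b => linComb (ρ.1 q.1.1.1) W (q.1.1.2, b) + 0) m)) _ _) k = _
  simp only [add_zero, keySymbol]

theorem linComb_key_eq_of_place_eq (hr : 0 < r) (hx : Function.Injective x)
    {ρ ρ' : (pLFR C r N t B e x).Rand} {W W' : Library N (Sub C t × Fin B)} {g : Sub C r}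
    (h : ∀ c ∈ g.1, (pLFR C r N t B e x).place c ρ W = (pLFR C r N t B e x).place c ρ' W')
    {T : Sub C t} (hT : Disjoint g.1 T.1) (b : Fin B) :
    linComb (ρ.1 g) W (T, b) = linComb (ρ'.1 g) W' (T, b) := by
  let q : KeyIx C r t := ⟨(g, T), hT⟩
  suffices hkey : (fun b => linComb (ρ.1 g) W (T, b)) = fun b => linComb (ρ'.1 g) W' (T, b) from
    congrFun hkey b
  refine block_injective (symBits_spec r).1 fun m => e.injective ?_
  refine eq_of_shamirShare_eq (a := ρ.2 q m) (a' := ρ'.2 q m) hr hx fun j => ?_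
  obtain ⟨c, hc, rfl⟩ := exists_position_eq g j
  refine e.symm.injective (funext fun k => ?_)
  have hk := congrFun (h c hc) (.inr (⟨q, hc⟩, m, k))
  rwa [pLFR_place_inr, pLFR_place_inr] at hk

theorem pLFR_decodable (hr : 0 < r) (hx : Function.Injective x) :
    (pLFR C r N t B e x).Decodable := by
  rintro g ⟨W, ρ, d⟩ ⟨W', ρ', d'⟩ h
  obtain ⟨hsend, hd, hplace⟩ := (Scheme.observation_eq_iff _).1 h
  rw [pLFR_send, pLFR_send] at hsend
  have hcached (T : Sub C t) (hT : ¬ Disjoint g.1 T.1) (b n) : W n (T, b) = W' n (T, b) := by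
    obtain ⟨c, hcg, hcT⟩ := Finset.not_disjoint_iff.1 hT
    exact congrFun (hplace c hcg) (.inl (n, ⟨T, hcT⟩, b))
  funext ⟨T, b⟩
  change linComb (d g) W (T, b) = linComb (d' g) W' (T, b)
  rw [← hd]
  by_cases hT : Disjoint g.1 T.1
  · have hmasked := linComb_eq_of_maskedSignal_eq hsend hcached hT b
    have hP : ρ.1 g = ρ'.1 g :=
      add_left_cancel ((congrFun (eq_of_maskedSignal_eq hsend) g).trans (hd ▸ rfl))
    rw [Pi.add_apply, linComb_add, linComb_add, Pi.add_apply, Pi.add_apply,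
      linComb_key_eq_of_place_eq hr hx hplace hT b, hP] at hmasked
    exact add_right_cancel hmasked
  · exact linComb_congr _ (hcached T hT b)

theorem exists_coeff_shift {L : Type} [Field L] {x : Fin r → L} (hx : ∀ j, x j ≠ 0)
    (g h : Sub C r) {s s' : L} (hs : h = g → s = s') :
    ∃ δ : Fin (r - 1) → L, ∀ a, ∀ c ∈ g.1, ∀ hc : c ∈ h.1,
      shamirShare s' (a + δ) (x (position h c hc)) = shamirShare s a (x (position h c hc)) := by
  by_cases hhg : h = g
  · exact ⟨0, fun a c _ _ => by rw [add_zero, hs hhg]⟩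
  obtain ⟨c₀, hc₀h, hc₀g⟩ := Finset.not_subset.1 (mt eq_of_val_subset_val hhg)
  obtain ⟨δ, hδ⟩ := exists_shamirShare_add_eq hx (position h c₀ hc₀h) s s'
  exact ⟨δ, fun a c hcg hc => hδ a _ fun hpos => hc₀g (position_injective h hc hc₀h hpos ▸ hcg)⟩

theorem pLFR_masked (hx : ∀ j, x j ≠ 0) : (pLFR C r N t B e x).Masked := by
  intro g W d d' hd
  let P' (P : Sub C r → Fin N → ZMod 2) : Sub C r → Fin N → ZMod 2 := P + (d - d')
  have hP'g (P) {h : Sub C r} (hh : h = g) : P h = P' P h := by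
    simp only [P', Pi.add_apply, Pi.sub_apply, hh, hd, sub_self, add_zero]
  choose δ hδ using fun P (q : KeyIx C r t) (m : Fin (B ⌈/⌉ symBits r)) =>
    exists_coeff_shift hx g q.1.1 (s := keySymbol e (P q.1.1) W q.1.2 m)
      (s' := keySymbol e (P' P q.1.1) W q.1.2 m) fun hq => by rw [hP'g P hq]
  let σ : Equiv.Perm (PrivacyRand C r N t B) :=
    Equiv.prodShear (Equiv.addRight (d - d')) fun P => Equiv.addRight (δ P)
  refine ⟨σ, fun ρ => (Scheme.observation_eq_iff _).2 ⟨?_, hd.symm, fun c hc => ?_⟩⟩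
  · have hmask : d' + (σ ρ).1 = d + ρ.1 := by
      change d' + (ρ.1 + (d - d')) = d + ρ.1
      abel
    rw [pLFR_send, pLFR_send]
    exact congrArg (maskedSignal · W) hmask
  · funext i
    rcases i with ⟨n, T, b⟩ | ⟨q, m, k⟩
    · rfl
    · rw [pLFR_place_inr, pLFR_place_inr]
      exact congrFun (congrArg e.symm (hδ ρ.1 q.1 m (ρ.2 q.1 m) c hc q.2)) k

end PLFR

/-! ### Sizes of the caches and of the signal -/

theorem natCard_sub_subtype {C : ℕ} (k : ℕ) (p : Finset (Fin C) → Prop) [DecidablePred p] :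
    Nat.card {T : Sub C k // p T.1} = ((Finset.univ.powersetCard k).filter p).card := by
  have e : {T : Sub C k // p T.1} ≃ (Finset.univ.powersetCard k).filter p :=
    (Equiv.subtypeSubtypeEquivSubtypeInter _ _).trans <| Equiv.subtypeEquivRight fun T => by
      simp [Finset.mem_powersetCard]
  rw [Nat.card_congr e, Nat.card_eq_fintype_card, Fintype.card_coe]

theorem natCard_sub (C k : ℕ) : Nat.card (Sub C k) = C.choose k := by
  rw [Nat.card_eq_fintype_card, Fintype.card_finset_len, Fintype.card_fin]

theorem natCard_sub_disjoint {C : ℕ} (k : ℕ) (g : Finset (Fin C)) :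
    Nat.card {T : Sub C k // Disjoint g T.1} = (C - g.card).choose k := by
  have hfilter : (Finset.univ.powersetCard k).filter (Disjoint g) = gᶜ.powersetCard k := by
    ext T
    simp [Finset.mem_powersetCard, Finset.subset_compl_iff_disjoint_left, and_comm]
  rw [natCard_sub_subtype, hfilter, Finset.card_powersetCard, Finset.card_compl, Fintype.card_fin]

theorem natCard_sub_mem {C k : ℕ} (hk : 0 < k) (c : Fin C) :
    Nat.card {T : Sub C k // c ∈ T.1} = (C - 1).choose (k - 1) := by
  have h := Finset.card_filter_powersetCard_subset {c} Finset.univ k (Finset.subset_univ _)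
    (by rwa [Finset.card_singleton])
  simpa only [Finset.singleton_subset_iff, Finset.card_singleton, Finset.card_fin,
    ← natCard_sub_subtype] using h

theorem natCard_sub_mem_mul {C : ℕ} (k : ℕ) (c : Fin C) :
    Nat.card {T : Sub C k // c ∈ T.1} * C = k * C.choose k := by
  obtain _ | k := k
  · have hempty : IsEmpty {T : Sub C 0 // c ∈ T.1} :=
      ⟨fun T => Finset.notMem_empty c (Finset.card_eq_zero.1 T.1.2 ▸ T.2)⟩
    rw [Nat.card_of_isEmpty, zero_mul, zero_mul]
  · rw [natCard_sub_mem k.succ_pos, Nat.succ_sub_one]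
    obtain ⟨n, rfl⟩ := Nat.exists_eq_add_one_of_ne_zero c.pos.ne'
    rw [Nat.add_sub_cancel, mul_comm, Nat.add_one_mul_choose_eq, mul_comm]

theorem natCard_keyIx_mem {C r : ℕ} (t : ℕ) (hr : 0 < r) (c : Fin C) :
    Nat.card {q : KeyIx C r t // c ∈ q.1.1.1} = (C - r).choose t * (C - 1).choose (r - 1) := by
  let E : {q : KeyIx C r t // c ∈ q.1.1.1} ≃
      Σ g : {g : Sub C r // c ∈ g.1}, {T : Sub C t // Disjoint g.1.1 T.1} :=
    { toFun := fun q => ⟨⟨q.1.1.1, q.2⟩, ⟨q.1.1.2, q.1.2⟩⟩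
      invFun := fun p => ⟨⟨(p.1.1, p.2.1), p.2.2⟩, p.1.2⟩
      left_inv := fun _ => rfl
      right_inv := fun _ => rfl }
  rw [Nat.card_congr E, Nat.card_sigma]
  simp only [natCard_sub_disjoint, fun g : {g : Sub C r // c ∈ g.1} => g.1.2]
  rw [Finset.sum_const, Finset.card_univ, ← Nat.card_eq_fintype_card, natCard_sub_mem hr,
    smul_eq_mul, mul_comm]

theorem natCeil_div_eq_ceilDiv (B : ℕ) {l : ℕ} (hl : 0 < l) : ⌈(B : ℝ) / l⌉₊ = B ⌈/⌉ l := by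
  refine eq_of_forall_ge_iff fun c => ?_
  rw [Nat.ceil_le, div_le_iff₀ (Nat.cast_pos.2 hl), ceilDiv_le_iff_le_mul hl, mul_comm]
  exact_mod_cast Iff.rfl

section PLFR

variable {C r N t B : ℕ} {e : (Fin (symBits r) → ZMod 2) ≃ ShareField r}
  {x : Fin r → ShareField r}

theorem natCard_pLFR_cacheIx (hr : 0 < r) (c : Fin C) :
    Nat.card ((pLFR C r N t B e x).CacheIx c) =
      N * (Nat.card {T : Sub C t // c ∈ T.1} * B) +
        (C - r).choose t * (C - 1).choose (r - 1) * (B ⌈/⌉ symBits r * symBits r) := by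
  change Nat.card ((Fin N × {T : Sub C t // c ∈ T.1} × Fin B) ⊕
      ({q : KeyIx C r t // c ∈ q.1.1.1} × Fin (B ⌈/⌉ symBits r) × Fin (symBits r))) = _
  simp only [Nat.card_sum, Nat.card_prod, natCard_keyIx_mem t hr, Nat.card_fin]

theorem natCard_pLFR_sendIx :
    Nat.card (pLFR C r N t B e x).SendIx = C.choose (t + r) * B + C.choose r * N := by
  change Nat.card ((Sub C (t + r) × Fin B) ⊕ (Sub C r × Fin N)) = _
  simp only [Nat.card_sum, Nat.card_prod, natCard_sub, Nat.card_fin]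

theorem cast_natCard_pLFR_cacheIx (hr : 0 < r) (c : Fin C) :
    (Nat.card ((pLFR C r N t B e x).CacheIx c) : ℝ) =
      (N : ℝ) * t / C * ((C.choose t * B : ℕ) : ℝ) +
        ((C - r).choose t : ℝ) * ((C - 1).choose (r - 1) : ℝ) *
          ((B ⌈/⌉ symBits r : ℕ) * (symBits r : ℝ)) := by
  have hC : (C : ℝ) ≠ 0 := Nat.cast_ne_zero.2 c.pos.ne'
  have hmem : (Nat.card {T : Sub C t // c ∈ T.1} : ℝ) * C = t * C.choose t :=
    mod_cast natCard_sub_mem_mul t c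
  rw [natCard_pLFR_cacheIx hr]
  push_cast
  rw [add_left_inj]
  field_simp
  linear_combination (N : ℝ) * B * hmem

theorem cast_natCard_pLFR_sendIx (ht : t ≤ C) :
    (Nat.card (pLFR C r N t B e x).SendIx : ℝ) =
      rateP C r t * ((C.choose t * B : ℕ) : ℝ) + (C.choose r : ℝ) * N := by
  have hb : (C.choose t : ℝ) ≠ 0 := Nat.cast_ne_zero.2 (Nat.choose_pos ht).ne'
  rw [natCard_pLFR_sendIx, rateP]
  push_cast
  field_simp

theorem natCard_pLFR_cacheIx_eq_memP (hr : 0 < r) (ht : t ≤ C) (hB : 0 < B) (c : Fin C) :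
    (Nat.card ((pLFR C r N t B e x).CacheIx c) : ℝ) =
      memP C r N (C.choose t * B) t * ((C.choose t * B : ℕ) : ℝ) := by
  have hb : (C.choose t : ℝ) ≠ 0 := Nat.cast_ne_zero.2 (Nat.choose_pos ht).ne'
  have hB' : (B : ℝ) ≠ 0 := Nat.cast_ne_zero.2 hB.ne'
  have hceil : ⌈((C.choose t * B : ℕ) : ℝ) / ((symBits r : ℝ) * (C.choose t : ℝ))⌉₊ =
      B ⌈/⌉ symBits r := by
    rw [Nat.cast_mul, mul_comm (symBits r : ℝ), mul_div_mul_left _ _ hb,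
      natCeil_div_eq_ceilDiv B (symBits_spec r).1]
  rw [cast_natCard_pLFR_cacheIx hr, memP, hceil]
  push_cast
  field_simp

end PLFR

/-! ### Memory sharing -/

namespace Scheme

variable {C r N : ℕ} {β γ : Type}

/-- The scheme `s` for files whose bits are named differently. -/
def relabel (s : Scheme C r N β) (f : β ≃ γ) : Scheme C r N γ where
  Rand := s.Rand
  CacheIx := s.CacheIx
  SendIx := s.SendIx
  finite_rand := inferInstance
  nonempty_rand := inferInstance
  finite_cacheIx := inferInstance
  finite_sendIx := inferInstance
  place c ρ W := s.place c ρ fun n b => W n (f b)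
  send ρ d W := s.send ρ d fun n b => W n (f b)

theorem Decodable.relabel {s : Scheme C r N β} (hs : s.Decodable) (f : β ≃ γ) :
    (s.relabel f).Decodable := by
  rintro g ⟨W, ρ, d⟩ ⟨W', ρ', d'⟩ h
  have hwanted := hs g (a := (fun n b => W n (f b), ρ, d)) (b := (fun n b => W' n (f b), ρ', d')) h
  funext b
  obtain ⟨b, rfl⟩ := f.surjective b
  exact congrFun hwanted b

theorem Masked.relabel {s : Scheme C r N β} (hs : s.Masked) (f : β ≃ γ) :
    (s.relabel f).Masked :=
  fun g W => hs g fun n b => W n (f b)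

section Share

variable {ι : Type} [Finite ι] {β : ι → Type}

/-- Memory sharing: the files are split into parts, and a scheme of its own, with independent
randomness, is applied to each part. -/
def share (s : ∀ i, Scheme C r N (β i)) : Scheme C r N (Σ i, β i) where
  Rand := ∀ i, (s i).Rand
  CacheIx c := Σ i, (s i).CacheIx c
  SendIx := Σ i, (s i).SendIx
  finite_rand := inferInstance
  nonempty_rand := inferInstance
  finite_cacheIx := inferInstance
  finite_sendIx := inferInstance
  place c ρ W j := (s j.1).place c (ρ j.1) (fun n b => W n ⟨j.1, b⟩) j.2
  send ρ d W j := (s j.1).send (ρ j.1) d (fun n b => W n ⟨j.1, b⟩) j.2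

variable {s : ∀ i, Scheme C r N (β i)}

theorem share_observation_eq_iff {g : Sub C r} {W W' : Library N (Σ i, β i)}
    {ρ ρ' : (share s).Rand} {d d' : Demands C r N} :
    (share s).observation g (W, ρ, d) = (share s).observation g (W', ρ', d') ↔
      d g = d' g ∧ ∀ i, (s i).observation g (fun n b => W n ⟨i, b⟩, ρ i, d) =
        (s i).observation g (fun n b => W' n ⟨i, b⟩, ρ' i, d') := by
  simp only [observation_eq_iff]
  refine ⟨fun ⟨hX, hd, hZ⟩ => ⟨hd, fun i => ⟨?_, hd, fun c hc => ?_⟩⟩,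
    fun ⟨hd, h⟩ => ⟨?_, hd, fun c hc => ?_⟩⟩
  · exact funext fun j => congrFun hX ⟨i, j⟩
  · exact funext fun j => congrFun (hZ c hc) ⟨i, j⟩
  · exact funext fun j => congrFun (h j.1).1 j.2
  · exact funext fun j => congrFun ((h j.1).2.2 c hc) j.2

theorem Decodable.share (hs : ∀ i, (s i).Decodable) : (share s).Decodable := by
  rintro g ⟨W, ρ, d⟩ ⟨W', ρ', d'⟩ h
  funext ⟨i, b⟩
  exact congrFun (hs i g ((share_observation_eq_iff.1 h).2 i)) b

theorem Masked.share (hs : ∀ i, (s i).Masked) : (share s).Masked := by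
  intro g W d d' hd
  choose σ hσ using fun i => hs i g (fun n b => W n ⟨i, b⟩) d d' hd
  exact ⟨Equiv.piCongrRight σ, fun ρ =>
    share_observation_eq_iff.2 ⟨hd.symm, fun i => hσ i (ρ i)⟩⟩

end Share

/-- The scheme which caches nothing and sends all files. -/
def uncoded (C r N : ℕ) (β : Type) [Finite β] : Scheme C r N β where
  Rand := Unit
  CacheIx _ := Empty
  SendIx := Fin N × β
  finite_rand := inferInstance
  nonempty_rand := inferInstance
  finite_cacheIx := inferInstance
  finite_sendIx := inferInstance
  place _ _ _ := Empty.elim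
  send _ _ W i := W i.1 i.2

theorem uncoded_decodable [Finite β] : (uncoded C r N β).Decodable := by
  rintro g ⟨W, ρ, d⟩ ⟨W', ρ', d'⟩ h
  obtain ⟨hX, hd, -⟩ := (observation_eq_iff _).1 h
  obtain rfl : W = W' := funext fun n => funext fun b => congrFun hX (n, b)
  exact congrArg (linComb · W) hd

theorem uncoded_masked [Finite β] : (uncoded C r N β).Masked :=
  fun _ _ _ _ hd =>
    ⟨Equiv.refl _, fun _ => (observation_eq_iff _).2 ⟨rfl, hd.symm, fun _ _ => rfl⟩⟩

/-- The scheme in which every cache stores all files and nothing is sent. -/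
def fullyCached (C r N : ℕ) (β : Type) [Finite β] : Scheme C r N β where
  Rand := Unit
  CacheIx _ := Fin N × β
  SendIx := Empty
  finite_rand := inferInstance
  nonempty_rand := inferInstance
  finite_cacheIx := inferInstance
  finite_sendIx := inferInstance
  place _ _ W i := W i.1 i.2
  send _ _ _ := Empty.elim

theorem fullyCached_decodable [Finite β] (hr : 0 < r) : (fullyCached C r N β).Decodable := by
  rintro g ⟨W, ρ, d⟩ ⟨W', ρ', d'⟩ h
  obtain ⟨-, hd, hZ⟩ := (observation_eq_iff _).1 h
  obtain ⟨c, hc⟩ : g.1.Nonempty := Finset.card_pos.1 (g.2.symm ▸ hr)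
  obtain rfl : W = W' := funext fun n => funext fun b => congrFun (hZ c hc) (n, b)
  exact congrArg (linComb · W) hd

theorem fullyCached_masked [Finite β] : (fullyCached C r N β).Masked :=
  fun _ _ _ _ hd =>
    ⟨Equiv.refl _, fun _ => (observation_eq_iff _).2 ⟨rfl, hd.symm, fun _ _ => rfl⟩⟩

end Scheme

/-- There is a decodable and masked scheme, hence a P-LFR scheme, for files of `F` bits, with caches
of at most `m` bits and a signal of at most `R` bits. -/
def Achievable (C r N F : ℕ) (m R : ℝ) : Prop :=
  ∃ s : Scheme C r N (Fin F), s.Decodable ∧ s.Masked ∧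
    (∀ c, (Nat.card (s.CacheIx c) : ℝ) ≤ m) ∧ (Nat.card s.SendIx : ℝ) ≤ R

section Achievable

variable {C r N F F' : ℕ} {m m' R R' : ℝ}

theorem achievable_of_scheme {β : Type} [Finite β] (s : Scheme C r N β) (hd : s.Decodable)
    (hm : s.Masked) (hF : Nat.card β = F) (hc : ∀ c, (Nat.card (s.CacheIx c) : ℝ) ≤ m)
    (hR : (Nat.card s.SendIx : ℝ) ≤ R) : Achievable C r N F m R :=
  ⟨s.relabel (Finite.equivFinOfCardEq hF), hd.relabel _, hm.relabel _, hc, hR⟩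

theorem Achievable.mono (h : Achievable C r N F m R) (hm : m ≤ m') (hR : R ≤ R') :
    Achievable C r N F m' R' := by
  obtain ⟨s, hdec, hmask, hcache, hsend⟩ := h
  exact ⟨s, hdec, hmask, fun c => (hcache c).trans hm, hsend.trans hR⟩

theorem Achievable.sum {ι : Type} [Fintype ι] {F : ι → ℕ} {m R : ι → ℝ}
    (h : ∀ i, Achievable C r N (F i) (m i) (R i)) :
    Achievable C r N (∑ i, F i) (∑ i, m i) (∑ i, R i) := by
  choose s hdec hmask hcache hsend using h
  refine achievable_of_scheme (Scheme.share s) (.share hdec) (.share hmask)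
    (by simp only [Nat.card_sigma, Nat.card_fin]) (fun c => ?_) ?_
  · change (Nat.card (Σ i, (s i).CacheIx c) : ℝ) ≤ _
    rw [Nat.card_sigma, Nat.cast_sum]
    exact Finset.sum_le_sum fun i _ => hcache i c
  · change (Nat.card (Σ i, (s i).SendIx) : ℝ) ≤ _
    rw [Nat.card_sigma, Nat.cast_sum]
    exact Finset.sum_le_sum fun i _ => hsend i

theorem Achievable.add (h : Achievable C r N F m R) (h' : Achievable C r N F' m' R') :
    Achievable C r N (F + F') (m + m') (R + R') := by
  have hsum := Achievable.sum (ι := Bool) (F := fun b => cond b F F') (m := fun b => cond b m m')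
    (R := fun b => cond b R R') (Bool.rec h' h)
  simpa only [Fintype.sum_bool, cond_true, cond_false] using hsum

theorem achievable_uncoded (C r N F : ℕ) : Achievable C r N F 0 (N * F) := by
  refine achievable_of_scheme (Scheme.uncoded C r N (Fin F)) Scheme.uncoded_decodable
    Scheme.uncoded_masked (Nat.card_fin F) (fun c => ?_) ?_
  · change (Nat.card Empty : ℝ) ≤ _
    simp
  · change (Nat.card (Fin N × Fin F) : ℝ) ≤ _
    simp

theorem achievable_fullyCached (hr : 0 < r) (C N F : ℕ) : Achievable C r N F (N * F) 0 := by
  refine achievable_of_scheme (Scheme.fullyCached C r N (Fin F))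
    (Scheme.fullyCached_decodable hr) Scheme.fullyCached_masked (Nat.card_fin F) (fun c => ?_) ?_
  · change (Nat.card (Fin N × Fin F) : ℝ) ≤ _
    simp
  · change (Nat.card Empty : ℝ) ≤ _
    simp

theorem Achievable.extend (h : Achievable C r N F' m R) (hF : F' ≤ F) :
    Achievable C r N F m (R + N * (F - F')) := by
  have hadd := h.add (achievable_uncoded C r N (F - F'))
  rwa [Nat.add_sub_cancel' hF, add_zero, Nat.cast_sub hF] at hadd

theorem exists_share_points (r : ℕ) :
    ∃ x : Fin r → ShareField r, Function.Injective x ∧ ∀ j, x j ≠ 0 := by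
  have hcard : Nat.card (ShareField r)ˣ = 2 ^ symBits r - 1 := by
    rw [Nat.card_units, GaloisField.card 2 _ (symBits_spec r).1.ne']
  have hle : r ≤ Nat.card (ShareField r)ˣ := hcard ▸ Nat.le_sub_one_of_lt (symBits_spec r).2
  exact ⟨fun j => ((Finite.equivFin (ShareField r)ˣ).symm (j.castLE hle)).1,
    Units.val_injective.comp <| (Equiv.injective _).comp <| Fin.castLE_injective hle,
    fun _ => Units.ne_zero _⟩

theorem nonempty_symbol_equiv (r : ℕ) :
    Nonempty ((Fin (symBits r) → ZMod 2) ≃ ShareField r) := by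
  refine Finite.card_eq.1 ?_
  rw [GaloisField.card 2 _ (symBits_spec r).1.ne']
  simp only [Nat.card_pi, Nat.card_zmod, Finset.prod_const, Finset.card_fin]

/-- The limit of `memP C r N F t` as `F` tends to infinity. Where no padding occurs, it is the
cache size of the P-LFR scheme. -/
def memLimit (C r N t : ℕ) : ℝ :=
  (N : ℝ) * t / C + ((C - r).choose t : ℝ) * ((C - 1).choose (r - 1) : ℝ) / (C.choose t : ℝ)

theorem achievable_pLFR (hr : 0 < r) {t : ℕ} (ht : t ≤ C) (n : ℕ) :
    Achievable C r N (C.choose t * symBits r * n)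
      (memLimit C r N t * (C.choose t * symBits r * n : ℕ))
      (rateP C r t * (C.choose t * symBits r * n : ℕ) + (C.choose r : ℝ) * N) := by
  obtain ⟨e⟩ := nonempty_symbol_equiv r
  obtain ⟨x, hx, hx0⟩ := exists_share_points r
  have hb : (C.choose t : ℝ) ≠ 0 := Nat.cast_ne_zero.2 (Nat.choose_pos ht).ne'
  rw [mul_assoc]
  refine achievable_of_scheme (pLFR C r N t (symBits r * n) e x) (pLFR_decodable hr hx)
    (pLFR_masked hx0) ?_ (fun c => ?_) (cast_natCard_pLFR_sendIx ht).le
  · simp only [Nat.card_prod, natCard_sub, Nat.card_fin]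
  · rw [cast_natCard_pLFR_cacheIx hr, ← smul_eq_mul (symBits r) n,
      smul_ceilDiv (symBits_spec r).1, smul_eq_mul, memLimit]
    refine le_of_eq ?_
    push_cast
    field_simp

end Achievable

/-! ### The lower convex envelope -/

/-- The memory-rate pair `p` is achievable for files of any real size `f`, up to a loss of at most
`L` bits of the files by rounding, and with at most `κ` additional bits in the signal. -/
def NearlyAchievable (C r N : ℕ) (L κ : ℝ) (p : ℝ × ℝ) : Prop :=
  ∀ f : ℝ, 0 ≤ f → ∃ F : ℕ, F ≤ f ∧ f - L ≤ F ∧ Achievable C r N F (p.1 * f) (p.2 * f + κ)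

section LowerConvexEnvelope

variable {C r N F : ℕ} {L κ L' κ' : ℝ} {p p' : ℝ × ℝ} {S : Set (ℝ × ℝ)}

theorem NearlyAchievable.mono (h : NearlyAchievable C r N L κ p) (hL : L ≤ L') (hκ : κ ≤ κ')
    (hp : p ≤ p') : NearlyAchievable C r N L' κ' p' := by
  intro f hf
  obtain ⟨F, hFf, hfF, hF⟩ := h f hf
  obtain ⟨hp₁, hp₂⟩ := Prod.le_def.1 hp
  exact ⟨F, hFf, by linarith, hF.mono (by gcongr) (by gcongr)⟩

theorem nearlyAchievable_of_forall_mul {b : ℕ} (hb : 0 < b) (hp : 0 ≤ p)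
    (h : ∀ n : ℕ, Achievable C r N (b * n) (p.1 * (b * n : ℕ)) (p.2 * (b * n : ℕ) + κ)) :
    NearlyAchievable C r N b κ p := by
  intro f hf
  obtain ⟨hp₁, hp₂⟩ := Prod.le_def.1 hp
  have hb' : (0 : ℝ) < b := Nat.cast_pos.2 hb
  have hle : ((b * ⌊f / b⌋₊ : ℕ) : ℝ) ≤ f := by
    have := Nat.floor_le (div_nonneg hf hb'.le)
    rwa [le_div_iff₀ hb', mul_comm, ← Nat.cast_mul] at this
  have hlt : f < b * ⌊f / b⌋₊ + b := by
    have := Nat.lt_floor_add_one (f / b)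
    rw [div_lt_iff₀ hb'] at this
    linarith
  refine ⟨b * ⌊f / b⌋₊, hle, ?_, (h _).mono ?_ ?_⟩
  · rw [Nat.cast_mul]
    linarith
  · exact mul_le_mul_of_nonneg_left hle hp₁
  · exact add_le_add_left (mul_le_mul_of_nonneg_left hle hp₂) κ

theorem nearlyAchievable_uncoded (C r N : ℕ) : NearlyAchievable C r N 1 0 (0, N) := by
  have h := nearlyAchievable_of_forall_mul (C := C) (r := r) (N := N) (κ := 0)
    (p := (0, N)) one_pos ⟨le_rfl, N.cast_nonneg⟩ fun n => ?_
  · rwa [Nat.cast_one] at h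
  · simpa using achievable_uncoded C r N n

theorem nearlyAchievable_fullyCached (hr : 0 < r) (C N : ℕ) :
    NearlyAchievable C r N 1 0 (N, 0) := by
  have h := nearlyAchievable_of_forall_mul (C := C) (r := r) (N := N) (κ := 0)
    (p := (N, 0)) one_pos ⟨N.cast_nonneg, le_rfl⟩ fun n => ?_
  · rwa [Nat.cast_one] at h
  · simpa using achievable_fullyCached hr C N n

theorem memLimit_nonneg (C r N t : ℕ) : 0 ≤ memLimit C r N t := by
  rw [memLimit]
  positivity

theorem rateP_nonneg (C r t : ℕ) : 0 ≤ rateP C r t := by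
  rw [rateP]
  positivity

theorem memLimit_le_memP (hF : 0 < F) (t : ℕ) : memLimit C r N t ≤ memP C r N F t := by
  have : (0 : ℝ) < F := Nat.cast_pos.2 hF
  have : (0 : ℝ) < symBits r := Nat.cast_pos.2 (symBits_spec r).1
  have hceil : ((C.choose t : ℝ))⁻¹ ≤
      ⌈(F : ℝ) / (symBits r * C.choose t)⌉₊ * (symBits r / F) := by
    calc ((C.choose t : ℝ))⁻¹ = F / (symBits r * C.choose t) * (symBits r / F) := by
          field_simp
      _ ≤ _ := by gcongr; exact Nat.le_ceil _
  rw [memLimit, memP, div_eq_mul_inv _ (C.choose t : ℝ), mul_assoc _ (Nat.cast _) (_ / _)]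
  gcongr

theorem nearlyAchievable_of_mem_cornerPoints (hr : 0 < r) (hF : 0 < F)
    (hp : p ∈ cornerPoints C r N F) :
    NearlyAchievable C r N (2 ^ C * symBits r) (C.choose r * N) p := by
  have hl : (1 : ℝ) ≤ symBits r := Nat.one_le_cast.2 (symBits_spec r).1
  have hL : (1 : ℝ) ≤ 2 ^ C * symBits r :=
    one_le_mul_of_one_le_of_one_le (one_le_pow₀ one_le_two) hl
  have hκ : (0 : ℝ) ≤ C.choose r * N := by positivity
  obtain (rfl | ⟨t, ht, rfl⟩) | rfl := hp
  · exact (nearlyAchievable_uncoded C r N).mono hL hκ le_rfl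
  · have hb : 0 < C.choose t * symBits r :=
      Nat.mul_pos (Nat.choose_pos (by omega)) (symBits_spec r).1
    have hlimit : NearlyAchievable C r N (C.choose t * symBits r : ℕ) (C.choose r * N)
        (memLimit C r N t, rateP C r t) :=
      nearlyAchievable_of_forall_mul hb ⟨memLimit_nonneg C r N t, rateP_nonneg C r t⟩
        (achievable_pLFR hr (by omega))
    refine hlimit.mono ?_ le_rfl ⟨memLimit_le_memP hF t, le_rfl⟩
    exact_mod_cast Nat.mul_le_mul_right _ (Nat.choose_le_two_pow C t)
  · exact (nearlyAchievable_fullyCached hr C N).mono hL hκ le_rfl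

theorem achievable_of_mem_convexHull (hL : 0 ≤ L) (hκ : 0 ≤ κ)
    (hS : ∀ y ∈ S, NearlyAchievable C r N L κ y) (hp : p ∈ convexHull ℝ S) (F : ℕ) :
    Achievable C r N F (p.1 * F) (p.2 * F + 3 * (N * L + κ)) := by
  obtain ⟨ι, _, z, w, hz, hind, hw, hw1, rfl⟩ := eq_pos_convex_span_of_mem_convexHull hp
  have hcard : (Fintype.card ι : ℝ) ≤ 3 := by
    have := hind.card_le_finrank_succ.trans (Nat.succ_le_succ (Submodule.finrank_le _))
    rw [Module.finrank_prod, Module.finrank_self] at this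
    exact_mod_cast this
  choose G hGle hGge hG using fun i =>
    hS (z i) (hz ⟨i, rfl⟩) (w i * F) (mul_nonneg (hw i).le F.cast_nonneg)
  have hwF : ∑ i, w i * (F : ℝ) = F := by rw [← Finset.sum_mul, hw1, one_mul]
  have hle : ∑ i, G i ≤ F := by
    have := Finset.sum_le_sum fun i (_ : i ∈ Finset.univ) => hGle i
    rw [hwF] at this
    exact_mod_cast this
  have hloss : (F : ℝ) - (∑ i, G i : ℕ) ≤ Fintype.card ι * L := by
    have := Finset.sum_le_sum fun i (_ : i ∈ Finset.univ) => hGge i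
    rw [Finset.sum_sub_distrib, hwF, Finset.sum_const, Finset.card_univ, nsmul_eq_mul] at this
    push_cast
    linarith
  refine ((Achievable.sum hG).extend hle).mono (le_of_eq ?_) ?_
  · simp only [Prod.fst_sum, Prod.smul_fst, smul_eq_mul, Finset.sum_mul]
    exact Finset.sum_congr rfl fun i _ => by ring
  · have hrate : ∑ i, (z i).2 * (w i * F) = (∑ i, w i • z i).2 * F := by
      simp only [Prod.snd_sum, Prod.smul_snd, smul_eq_mul, Finset.sum_mul]
      exact Finset.sum_congr rfl fun i _ => by ring
    rw [Finset.sum_add_distrib, hrate, Finset.sum_const, Finset.card_univ, nsmul_eq_mul, add_assoc]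
    gcongr
    calc Fintype.card ι * κ + N * (F - (∑ i, G i : ℕ))
        ≤ Fintype.card ι * κ + N * (Fintype.card ι * L) := by gcongr
      _ = Fintype.card ι * (N * L + κ) := by ring
      _ ≤ 3 * (N * L + κ) := by gcongr

theorem achievable_lowerConvexEnvelope (hL : 0 ≤ L) (hκ : 0 ≤ κ)
    (hS : ∀ y ∈ S, NearlyAchievable C r N L κ y) {M : ℝ} (hM : M ∈ Prod.fst '' convexHull ℝ S)
    (hF : 0 < F) :
    Achievable C r N F (M * F) (lowerConvexEnvelope S M * F + (3 * (N * L + κ) + 1)) := by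
  have hF' : (0 : ℝ) < F := Nat.cast_pos.2 hF
  obtain ⟨p, hp, rfl⟩ := hM
  obtain ⟨R, hR, hlt⟩ := Real.lt_sInf_add_pos
    (s := {R : ℝ | (p.1, R) ∈ convexHull ℝ S}) ⟨p.2, hp⟩ (one_div_pos.2 hF')
  refine (achievable_of_mem_convexHull hL hκ hS hR F).mono le_rfl ?_
  calc R * F + 3 * (N * L + κ)
      ≤ (lowerConvexEnvelope S p.1 + 1 / F) * F + 3 * (N * L + κ) := by
        gcongr
        exact hlt.le
    _ = _ := by
        field_simp
        ring

end LowerConvexEnvelope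

end MultiAccess

end

theorem theorem2 (C r N : ℕ) (hr : 0 < r) (hrC : r ≤ C) :
    (∀ t B : ℕ, t + r ≤ C → 0 < B →
      ∀ (e : (Fin (MultiAccess.symBits r) → ZMod 2) ≃ MultiAccess.ShareField r)
        (x : Fin r → MultiAccess.ShareField r), Function.Injective x → (∀ j, x j ≠ 0) →
        (MultiAccess.pLFR C r N t B e x).IsPLFR ∧
        (∀ c, (Nat.card ((MultiAccess.pLFR C r N t B e x).CacheIx c) : ℝ) =
          MultiAccess.memP C r N (C.choose t * B) t * ((C.choose t * B : ℕ) : ℝ)) ∧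
        (Nat.card (MultiAccess.pLFR C r N t B e x).SendIx : ℝ) =
          MultiAccess.rateP C r t * ((C.choose t * B : ℕ) : ℝ) + (C.choose r : ℝ) * N) ∧
    (∃ κ : ℝ, ∀ F : ℕ, 0 < F →
      ∀ M ∈ Prod.fst '' convexHull ℝ (MultiAccess.cornerPoints C r N F),
        ∃ s : MultiAccess.Scheme C r N (Fin F), s.IsPLFR ∧
          (∀ c, (Nat.card (s.CacheIx c) : ℝ) ≤ M * F) ∧
          (Nat.card s.SendIx : ℝ) ≤
            MultiAccess.lowerConvexEnvelope (MultiAccess.cornerPoints C r N F) M * F + κ) := by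
  refine ⟨fun t B ht hB e x hx hx0 => ⟨?_, ?_, ?_⟩, ?_⟩
  · exact MultiAccess.Scheme.isPLFR_of_decodable_of_masked (MultiAccess.pLFR_decodable hr hx)
      (MultiAccess.pLFR_masked hx0)
  · exact MultiAccess.natCard_pLFR_cacheIx_eq_memP hr (by omega) hB
  · exact MultiAccess.cast_natCard_pLFR_sendIx (by omega)
  · refine ⟨3 * (N * (2 ^ C * MultiAccess.symBits r) + C.choose r * N) + 1, fun F hF M hM => ?_⟩
    obtain ⟨s, hdec, hmask, hcache, hsend⟩ :=
      MultiAccess.achievable_lowerConvexEnvelope (by positivity) (by positivity)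
        (fun _ => MultiAccess.nearlyAchievable_of_mem_cornerPoints hr hF) hM hF
    exact ⟨s, MultiAccess.Scheme.isPLFR_of_decodable_of_masked hdec hmask, hcache, hsend⟩
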